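/- Let $\pi:Z\to X$ be a smooth principal circle bundle over a smooth (finite-dimensional, Hausdorff, second countable, boundaryless) manifold $X$, with structure group $\mathbb T=\mathbb R/\mathbb Z\cong U(1)$, acting through $t\mapsto e^{2\pi i t}$. Let $v$ be the vector field generating the $\mathbb T$-action, and let $A$ be a $\mathbb T$-invariant connection 1-form on $Z$, normalized (by dropping the factor $2\pi i$) as a smooth real-valued $\mathbb T$-invariant 1-form with $A(v)=1$. For a smooth loop $\gamma:S^1=\mathbb R/\mathbb Z\to X$, the holonomy $\mathrm{hol}^Z(\gamma)\in U(1)$ is the element $g$ such that every horizontal lift $y$ of $\gamma$ (a smooth curve in $Z$ with $\pi(y(s))=\gamma(s)$ and $A(\dot y(s))=0$ for all $s$), from any starting point $y(0)$ of the fibre over $\gamma(0)$, satisfies $y(1)=g\cdot y(0)$. Let $$L^{\mathcal Q}Z=\{x:S^1\to Z \text{ a smooth loop} \mid A(\dot x(s))\in\mathbb Z \text{ for all } s\in[0,1]\}.$$ Then the following hold. 1. If $x\in L^{\mathcal Q}Z$, then the holonomy $\mathrm{hol}^Z(\pi\circ x)$ of $Z$ along the projected loop $\pi\circ x$ is trivial.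 2. For every smooth loop $x:S^1\to Z$, the integral $\int_0^1 A(\dot x(s))\,ds$ is an integer if and only if $\mathrm{hol}^Z(\pi\circ x)$ is trivial. Here $\mathrm{hol}^Z(\pi\circ x)$ is well defined for every smooth loop $x$ in $Z$: horizontal lifts of $\pi\circ x$ exist from every point of the fibre over $\pi(x(0))$, and there is exactly one element $g\in U(1)$ as above. -/

import Mathlib

open scoped Manifold ContDiff

namespace CircleBundle

section Curves

variable {E : Type*} [NormedAddCommGroup E] [NormedSpace ℝ E]
  {H : Type*} [TopologicalSpace H] (I : ModelWithCorners ℝ E H)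
  {M : Type*} [TopologicalSpace M] [ChartedSpace H M]

/-- The velocity `ċ(s)`, a tangent vector at `c s`, of a curve `c` in a manifold. -/
noncomputable def velocity (c : ℝ → M) (s : ℝ) : TangentSpace I (c s) :=
  mfderiv 𝓘(ℝ, ℝ) I c s (1 : ℝ)

variable (M) in
/-- A smooth loop `S¹ = ℝ/ℤ → M`, given as a smooth curve of period one. -/
structure SmoothLoop where
  toFun : ℝ → M
  contMDiff : ContMDiff 𝓘(ℝ, ℝ) I ∞ toFun
  periodic : Function.Periodic toFun 1

/-- The image `f ∘ x` of a smooth loop under a smooth map. -/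
def SmoothLoop.map {E' : Type*} [NormedAddCommGroup E'] [NormedSpace ℝ E']
    {H' : Type*} [TopologicalSpace H'] {I' : ModelWithCorners ℝ E' H'}
    {N : Type*} [TopologicalSpace N] [ChartedSpace H' N]
    {I : ModelWithCorners ℝ E H} (x : SmoothLoop I M) (f : M → N) (hf : ContMDiff I I' ∞ f) :
    SmoothLoop I' N where
  toFun := f ∘ x.toFun
  contMDiff := hf.comp x.contMDiff
  periodic := x.periodic.comp f

/-- The orbit `t ↦ e^{2πit} • z` of the circle action. Its velocity at `t = 0` is the value at `z`
of the vector field `v` that generates the action of `𝕋 = ℝ/ℤ`. -/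
noncomputable def orbitCurve [MulAction Circle M] (z : M) (t : ℝ) : M :=
  Circle.exp (2 * Real.pi * t) • z

end Curves

section Bundle

variable {EX : Type*} [NormedAddCommGroup EX] [NormedSpace ℝ EX]
  {HX : Type*} [TopologicalSpace HX] (IX : ModelWithCorners ℝ EX HX)
  {X : Type*} [TopologicalSpace X] [ChartedSpace HX X]
  {EZ : Type*} [NormedAddCommGroup EZ] [NormedSpace ℝ EZ]
  {HZ : Type*} [TopologicalSpace HZ] (IZ : ModelWithCorners ℝ EZ HZ)
  {Z : Type*} [TopologicalSpace Z] [ChartedSpace HZ Z] [MulAction Circle Z]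

/-- `π : Z → X` is a smooth principal circle bundle: the circle acts smoothly on `Z`, and `π` is
smoothly and equivariantly locally trivial, where the circle acts on `U × Circle` by multiplication
on the second factor. -/
structure IsPrincipalCircleBundle (π : Z → X) : Prop where
  contMDiffSMul : ContMDiffSMul (𝓡 1) IZ ∞ Circle Z
  contMDiff_proj : ContMDiff IZ IX ∞ π
  exists_trivialization : ∀ b : X, ∃ e : Bundle.Trivialization Circle π,
    b ∈ e.baseSet ∧
    ContMDiffOn IZ (IX.prod (𝓡 1)) ∞ e e.source ∧
    ContMDiffOn (IX.prod (𝓡 1)) IZ ∞ e.toOpenPartialHomeomorph.symm e.target ∧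
    ∀ z ∈ e.source, ∀ g : Circle, g • z ∈ e.source ∧ e (g • z) = ((e z).1, g * (e z).2)

variable [IsManifold IZ ∞ Z]

/-- `A` is a circle-invariant connection 1-form on the principal circle bundle with total space `Z`,
with the factor `2πi` dropped: a smooth real-valued 1-form with `A(v) = 1`, invariant under the
action. -/
structure IsConnectionForm (A : ∀ z : Z, TangentSpace IZ z →L[ℝ] ℝ) : Prop where
  contMDiff : ContMDiff IZ (IZ.prod 𝓘(ℝ, EZ →L[ℝ] ℝ)) ∞
    (fun z => Bundle.TotalSpace.mk' (EZ →L[ℝ] ℝ)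
      (E := fun z : Z => TangentSpace IZ z →L[ℝ] ℝ) z (A z))
  map_generator : ∀ z : Z, A (orbitCurve z 0) (velocity IZ (orbitCurve z) 0) = 1
  invariant : ∀ (g : Circle) (z : Z) (w : TangentSpace IZ z),
    A (g • z) (mfderiv IZ IZ (fun y : Z => g • y) z w) = A z w

/-- `y` is a horizontal lift of the loop `γ`: a smooth curve in `Z` over `γ` (a curve on `ℝ`, with
`γ` run through periodically) whose velocity is annihilated by the connection form. A horizontal
lift need not be periodic. -/
structure IsHorizontalLift (π : Z → X) (A : ∀ z : Z, TangentSpace IZ z →L[ℝ] ℝ)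
    (γ : SmoothLoop IX X) (y : ℝ → Z) : Prop where
  contMDiff : ContMDiff 𝓘(ℝ, ℝ) IZ ∞ y
  proj_eq : ∀ s, π (y s) = γ.toFun s
  horizontal : ∀ s, A (y s) (velocity IZ y s) = 0

/-- `g` is the holonomy along `γ`: parallel transport once around `γ` is defined at every point of
the fibre over `γ 0`, and it is the action of `g` there. -/
def IsHolonomy (π : Z → X) (A : ∀ z : Z, TangentSpace IZ z →L[ℝ] ℝ)
    (γ : SmoothLoop IX X) (g : Circle) : Prop :=
  ∀ z : Z, π z = γ.toFun 0 →
    (∃ y, IsHorizontalLift IX IZ π A γ y ∧ y 0 = z) ∧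
    ∀ y, IsHorizontalLift IX IZ π A γ y → y 0 = z → y 1 = g • z

/-- The holonomy `hol^Z(γ)` of the circle bundle with connection along the loop `γ` in the base. -/
noncomputable def holonomy (π : Z → X) (A : ∀ z : Z, TangentSpace IZ z →L[ℝ] ℝ)
    (γ : SmoothLoop IX X) : Circle :=
  Classical.epsilon (IsHolonomy IX IZ π A γ)

/-- The winding quantized loop space: the smooth loops `x` in `Z` with `A(ẋ(s)) ∈ ℤ` for all
`s ∈ [0,1]`. -/
def windingQLoopSpace (A : ∀ z : Z, TangentSpace IZ z →L[ℝ] ℝ) : Set (SmoothLoop IZ Z) :=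
  {x | ∀ s ∈ Set.Icc (0 : ℝ) 1, ∃ m : ℤ, A (x.toFun s) (velocity IZ x.toFun s) = m}

end Bundle

end CircleBundle

/-! Put `a(s) = A(ẋ(s))`. Moving a curve along the orbits by a real function `φ` changes the value
of `A` on its velocity by `φ'` (`IsConnectionForm.form_velocity_orbitCurve`): `A(v) = 1` accounts
for `φ'`, and invariance keeps the rest. With `φ(s) = -∫₀ˢ a` the loop `x` becomes a horizontal lift
of `π ∘ x`. As `x 1 = x 0`, this lift ends at `exp(-2πi ∫₀¹ a)` times its starting point.

The same formula shows that two horizontal lifts differ by a constant element of the circle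
(`IsHorizontalLift.eq_smul`), so this factor is the holonomy (`isHolonomy_map_iff`). It is trivial
exactly when `∫₀¹ a` is an integer. For a winding quantized loop, `a` is continuous and
integer-valued on `[0,1]`, hence constant there, and its integral is that integer. -/

namespace CircleBundle

/-! ### Velocities of curves and their pairing with a 1-form -/

section Speed

variable {EZ : Type*} [NormedAddCommGroup EZ] [NormedSpace ℝ EZ]
  {HZ : Type*} [TopologicalSpace HZ] {IZ : ModelWithCorners ℝ EZ HZ}
  {Z : Type*} [TopologicalSpace Z] [ChartedSpace HZ Z]

theorem form_velocity_congr (A : ∀ z : Z, TangentSpace IZ z →L[ℝ] ℝ) {c c' : ℝ → Z} {s : ℝ}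
    (h : c =ᶠ[nhds s] c') :
    A (c s) (velocity IZ c s) = A (c' s) (velocity IZ c' s) := by
  -- Every tangent space is a copy of `EZ`; forgetting the base point lets it be rewritten
  -- independently of the vector.
  let B : Z → EZ → ℝ := fun z w => A z w
  change B (c s) (mfderiv 𝓘(ℝ, ℝ) IZ c s (1 : ℝ)) = B (c' s) (mfderiv 𝓘(ℝ, ℝ) IZ c' s (1 : ℝ))
  rw [h.mfderiv_eq, h.eq_of_nhds]

/-- The chain rule for velocities, for a curve followed by a map. -/
theorem velocity_comp {EN : Type*} [NormedAddCommGroup EN] [NormedSpace ℝ EN]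
    {HN : Type*} [TopologicalSpace HN] {IN : ModelWithCorners ℝ EN HN}
    {N : Type*} [TopologicalSpace N] [ChartedSpace HN N] {f : Z → N} {c : ℝ → Z} {s : ℝ}
    (hf : MDifferentiableAt IZ IN f (c s)) (hc : MDifferentiableAt 𝓘(ℝ, ℝ) IZ c s) :
    velocity IN (fun t => f (c t)) s = mfderiv IZ IN f (c s) (velocity IZ c s) := by
  unfold velocity
  change mfderiv 𝓘(ℝ, ℝ) IN (f ∘ c) s (1 : ℝ) = _
  rw [mfderiv_comp s hf hc]
  rfl

/-- The chain rule for velocities, for a change of parameter. -/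
theorem velocity_comp_real {c : ℝ → Z} {φ : ℝ → ℝ} {φ' s : ℝ}
    (hc : MDifferentiableAt 𝓘(ℝ, ℝ) IZ c (φ s)) (hφ : HasDerivAt φ φ' s) :
    velocity IZ (fun t => c (φ t)) s = φ' • velocity IZ c (φ s) := by
  rw [velocity_comp (IZ := 𝓘(ℝ, ℝ)) hc hφ.differentiableAt.mdifferentiableAt]
  have : velocity 𝓘(ℝ, ℝ) φ s = φ' • (1 : ℝ) := by
    unfold velocity
    rw [mfderiv_eq_fderiv, hφ.hasFDerivAt.fderiv]
    exact one_smul ℝ φ' |>.trans (mul_one φ').symm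
  rw [this]
  exact map_smul (mfderiv 𝓘(ℝ, ℝ) IZ c (φ s)) φ' (1 : ℝ)

/-- The Leibniz rule for the velocity of a curve moved by a curve of maps. -/
theorem velocity_prod {F : ℝ × Z → Z} {φ : ℝ → ℝ} {x : ℝ → Z} {φ' s : ℝ}
    (hF : MDifferentiableAt (𝓘(ℝ, ℝ).prod IZ) IZ F (φ s, x s))
    (hφ : HasDerivAt φ φ' s) (hx : MDifferentiableAt 𝓘(ℝ, ℝ) IZ x s) :
    velocity IZ (fun t => F (φ t, x t)) s =
      φ' • velocity IZ (fun t => F (t, x s)) (φ s) +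
        mfderiv IZ IZ (fun z => F (φ s, z)) (x s) (velocity IZ x s) := by
  have hφm : MDifferentiableAt 𝓘(ℝ, ℝ) 𝓘(ℝ, ℝ) φ s := hφ.differentiableAt.mdifferentiableAt
  have h1 : MDifferentiableAt 𝓘(ℝ, ℝ) IZ (fun t => F (t, x s)) (φ s) :=
    MDifferentiableAt.comp (φ s) (g := F) (f := fun t => (t, x s)) hF
      (mdifferentiableAt_id.prodMk mdifferentiableAt_const)
  rw [← velocity_comp_real h1 hφ, velocity_comp (IZ := 𝓘(ℝ, ℝ)) h1 hφm]
  have hp := velocity_comp (f := F) (c := fun t => (φ t, x t)) hF (hφm.prodMk hx)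
  rw [hp, mfderiv_prod_eq_add_apply hF]
  have hv : velocity (𝓘(ℝ, ℝ).prod IZ) (fun t => (φ t, x t)) s =
      (velocity 𝓘(ℝ, ℝ) φ s, velocity IZ x s) := by
    unfold velocity
    rw [mfderiv_prodMk hφm hx]
    rfl
  rw [hv]

variable [IsManifold IZ ∞ Z]

/-- The velocity is the tangent map of `c` applied to the unit section of `Tℝ`, hence a smooth curve
in the tangent bundle. -/
theorem contDiff_form_velocity {A : ∀ z : Z, TangentSpace IZ z →L[ℝ] ℝ}
    (hA : ContMDiff IZ (IZ.prod 𝓘(ℝ, EZ →L[ℝ] ℝ)) ∞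
      (fun z => Bundle.TotalSpace.mk' (EZ →L[ℝ] ℝ)
        (E := fun z : Z => TangentSpace IZ z →L[ℝ] ℝ) z (A z)))
    {c : ℝ → Z} (hc : ContMDiff 𝓘(ℝ, ℝ) IZ ∞ c) :
    ContDiff ℝ ∞ fun s => A (c s) (velocity IZ c s) := by
  have h1 : ContMDiff 𝓘(ℝ, ℝ) (𝓘(ℝ, ℝ).prod 𝓘(ℝ, ℝ)) ∞
      (fun s : ℝ => (⟨s, (1 : ℝ)⟩ : TangentBundle 𝓘(ℝ, ℝ) ℝ)) := by
    exact contMDiff_vectorSpace_iff_contDiff.2 contDiff_const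
  have hv : ContMDiff 𝓘(ℝ, ℝ) (IZ.prod 𝓘(ℝ, EZ)) ∞
      (fun s => Bundle.TotalSpace.mk' EZ (E := TangentSpace IZ) (c s) (velocity IZ c s)) :=
    (hc.contMDiff_tangentMap (m := ∞) le_rfl).comp h1
  have h := ContMDiff.clm_bundle_apply (F₂ := ℝ) (E₂ := Bundle.Trivial Z ℝ) (hA.comp hc) hv
  rw [← contMDiff_iff_contDiff]
  intro s
  exact (Bundle.contMDiffAt_totalSpace.1 (h s)).2

end Speed

/-! ### The connection form along the circle action -/

section Orbit

theorem orbitCurve_add {Z : Type*} [MulAction Circle Z] (z : Z) (a b : ℝ) :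
    orbitCurve z (a + b) = orbitCurve (orbitCurve z a) b := by
  simp only [orbitCurve, ← mul_smul, ← Circle.exp_add]
  ring_nf

variable {EZ : Type*} [NormedAddCommGroup EZ] [NormedSpace ℝ EZ]
  {HZ : Type*} [TopologicalSpace HZ] {IZ : ModelWithCorners ℝ EZ HZ}
  {Z : Type*} [TopologicalSpace Z] [ChartedSpace HZ Z] [MulAction Circle Z]

theorem contMDiff_orbitCurve_uncurry [ContMDiffSMul (𝓡 1) IZ ∞ Circle Z] :
    ContMDiff (𝓘(ℝ, ℝ).prod IZ) IZ ∞ fun p : ℝ × Z => orbitCurve p.2 p.1 := by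
  unfold orbitCurve
  have h : ContMDiff (𝓘(ℝ, ℝ).prod IZ) (𝓡 1) ∞
      fun p : ℝ × Z => Circle.exp (2 * Real.pi * p.1) := by
    refine contMDiff_circleExp.comp ?_
    exact (contDiff_const.mul contDiff_id).contMDiff.comp contMDiff_fst
  exact h.smul contMDiff_snd

theorem contMDiff_const_smul_circle [ContMDiffSMul (𝓡 1) IZ ∞ Circle Z] (g : Circle) :
    ContMDiff IZ IZ ∞ fun z : Z => g • z :=
  (contMDiff_const (I' := 𝓡 1)).smul contMDiff_id

theorem mdifferentiableAt_orbitCurve [ContMDiffSMul (𝓡 1) IZ ∞ Circle Z] (z : Z) (t : ℝ) :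
    MDifferentiableAt 𝓘(ℝ, ℝ) IZ (orbitCurve z) t :=
  ((contMDiff_orbitCurve_uncurry (IZ := IZ)).comp
    (contMDiff_id.prodMk (contMDiff_const (c := z)))).mdifferentiable (by simp) t

variable [IsManifold IZ ∞ Z] {A : ∀ z : Z, TangentSpace IZ z →L[ℝ] ℝ}

/-- The normalization is given at time `0` only; restarting the orbit at its point at time `t`
carries it to time `t`. -/
theorem IsConnectionForm.map_velocity_orbitCurve [ContMDiffSMul (𝓡 1) IZ ∞ Circle Z]
    (hA : IsConnectionForm IZ A) (z : Z) (t : ℝ) :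
    A (orbitCurve z t) (velocity IZ (orbitCurve z) t) = 1 := by
  have h : orbitCurve z = fun r => orbitCurve (orbitCurve z t) (r - t) := by
    funext r
    rw [← orbitCurve_add]
    congr 1
    ring
  rw [form_velocity_congr A (Filter.EventuallyEq.of_eq h),
    velocity_comp_real (c := orbitCurve (orbitCurve z t)) (φ := fun r => r - t)
      (mdifferentiableAt_orbitCurve _ _) ((hasDerivAt_id t).sub_const t)]
  simp only [one_smul]
  rw [sub_self]
  exact hA.map_generator _

theorem IsConnectionForm.form_velocity_smul [ContMDiffSMul (𝓡 1) IZ ∞ Circle Z]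
    (hA : IsConnectionForm IZ A) (g : Circle) {x : ℝ → Z} {s : ℝ}
    (hx : MDifferentiableAt 𝓘(ℝ, ℝ) IZ x s) :
    A (g • x s) (velocity IZ (fun t => g • x t) s) = A (x s) (velocity IZ x s) := by
  rw [velocity_comp ((contMDiff_const_smul_circle g).mdifferentiable (by simp) _) hx]
  exact hA.invariant _ _ _

/-- By the Leibniz rule the velocity is `φ'` times the generator plus the translate of `ẋ` by a
fixed group element; normalization evaluates the first term, invariance the second. -/
theorem IsConnectionForm.form_velocity_orbitCurve [ContMDiffSMul (𝓡 1) IZ ∞ Circle Z]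
    (hA : IsConnectionForm IZ A) {φ : ℝ → ℝ} {x : ℝ → Z} {φ' s : ℝ}
    (hφ : HasDerivAt φ φ' s) (hx : MDifferentiableAt 𝓘(ℝ, ℝ) IZ x s) :
    A (orbitCurve (x s) (φ s)) (velocity IZ (fun t => orbitCurve (x t) (φ t)) s) =
      φ' + A (x s) (velocity IZ x s) := by
  rw [velocity_prod (F := fun p : ℝ × Z => orbitCurve p.2 p.1)
    (contMDiff_orbitCurve_uncurry.mdifferentiable (by simp) _) hφ hx]
  have h1 := hA.map_velocity_orbitCurve (x s) (φ s)
  have h2 := hA.invariant (Circle.exp (2 * Real.pi * φ s)) (x s) (velocity IZ x s)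
  refine (map_add (A (orbitCurve (x s) (φ s))) _ _).trans ?_
  refine congrArg₂ (· + ·) ?_ h2
  refine (map_smul (A (orbitCurve (x s) (φ s))) _ _).trans ?_
  rw [h1, smul_eq_mul, mul_one]

end Orbit

/-! ### Fibres, horizontal lifts and holonomy -/

section Bundle

variable {EX : Type*} [NormedAddCommGroup EX] [NormedSpace ℝ EX]
  {HX : Type*} [TopologicalSpace HX] {IX : ModelWithCorners ℝ EX HX}
  {X : Type*} [TopologicalSpace X] [ChartedSpace HX X]
  {EZ : Type*} [NormedAddCommGroup EZ] [NormedSpace ℝ EZ]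
  {HZ : Type*} [TopologicalSpace HZ] {IZ : ModelWithCorners ℝ EZ HZ}
  {Z : Type*} [TopologicalSpace Z] [ChartedSpace HZ Z] [MulAction Circle Z]
  {π : Z → X} {A : ∀ z : Z, TangentSpace IZ z →L[ℝ] ℝ}

theorem IsPrincipalCircleBundle.proj_smul (hπ : IsPrincipalCircleBundle IX IZ π)
    (g : Circle) (z : Z) : π (g • z) = π z := by
  obtain ⟨e, hb, -, -, he⟩ := hπ.exists_trivialization (π z)
  have hz : z ∈ e.source := e.mem_source.2 hb
  obtain ⟨h1, h2⟩ := he z hz g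
  rw [← e.coe_fst h1, h2, e.coe_fst hz]

theorem IsPrincipalCircleBundle.smul_left_injective (hπ : IsPrincipalCircleBundle IX IZ π)
    (z : Z) : Function.Injective fun g : Circle => g • z := by
  intro g g' h
  obtain ⟨e, hb, -, -, he⟩ := hπ.exists_trivialization (π z)
  have hz : z ∈ e.source := e.mem_source.2 hb
  have h1 := (he z hz g).2
  rw [show g • z = g' • z from h, (he z hz g').2] at h1
  exact (mul_right_cancel (congrArg Prod.snd h1)).symm

theorem IsPrincipalCircleBundle.exists_smul_eq (hπ : IsPrincipalCircleBundle IX IZ π)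
    {z z' : Z} (h : π z' = π z) : ∃ g : Circle, z' = g • z := by
  obtain ⟨e, hb, -, -, he⟩ := hπ.exists_trivialization (π z)
  have hz : z ∈ e.source := e.mem_source.2 hb
  have hz' : z' ∈ e.source := e.mem_source.2 (h ▸ hb)
  refine ⟨(e z').2 * (e z).2⁻¹, e.injOn hz' (he z hz _).1 ?_⟩
  change e z' = e _
  rw [(he z hz _).2]
  refine Prod.ext ?_ (by simp)
  rw [e.coe_fst hz', e.coe_fst hz, h]

/-- In an equivariant trivialization, `g` is the quotient of the fibre coordinates of `y'` and `y`.
-/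
theorem IsPrincipalCircleBundle.differentiable_of_smul_eq
    (hπ : IsPrincipalCircleBundle IX IZ π) {y y' : ℝ → Z}
    (hy : ContMDiff 𝓘(ℝ, ℝ) IZ ∞ y) (hy' : ContMDiff 𝓘(ℝ, ℝ) IZ ∞ y')
    {g : ℝ → Circle} (hg : ∀ s, y' s = g s • y s) : Differentiable ℝ fun s => (g s : ℂ) := by
  intro s
  obtain ⟨e, hb, hes, -, he⟩ := hπ.exists_trivialization (π (y s))
  have hys : y s ∈ e.source := e.mem_source.2 hb
  have hys' : y' s ∈ e.source := e.mem_source.2 (by rwa [hg, hπ.proj_smul])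
  have hdiff : ∀ c : ℝ → Z, ContMDiff 𝓘(ℝ, ℝ) IZ ∞ c → c s ∈ e.source →
      DifferentiableAt ℝ (fun t => ((e (c t)).2 : ℂ)) s := by
    intro c hc hcs
    have h1 : ContMDiffAt 𝓘(ℝ, ℝ) (IX.prod (𝓡 1)) ∞ (fun t => e (c t)) s :=
      (hes.contMDiffAt (e.open_source.mem_nhds hcs)).comp s hc.contMDiffAt
    have := finrank_real_complex_fact'
    have h2 : ContMDiff (𝓡 1) 𝓘(ℝ, ℂ) ∞ (fun z : Circle => (z : ℂ)) := contMDiff_coe_sphere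
    have h3 : ContMDiffAt 𝓘(ℝ, ℝ) 𝓘(ℝ, ℂ) ∞ (fun t => ((e (c t)).2 : ℂ)) s :=
      h2.contMDiffAt.comp s (contMDiffAt_snd.comp s h1)
    exact h3.contDiffAt.differentiableAt (by simp)
  have heq : (fun t => (g t : ℂ)) =ᶠ[nhds s] fun t => ((e (y' t)).2 : ℂ) / ((e (y t)).2 : ℂ) := by
    filter_upwards [hy.continuous.continuousAt.preimage_mem_nhds (e.open_source.mem_nhds hys)]
      with t ht
    rw [hg t, (he _ ht _).2, ← Circle.coe_div]
    simp
  exact ((hdiff y' hy' hys').div (hdiff y hy hys) (Circle.coe_ne_zero _)).congr_of_eventuallyEq heq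

variable [IsManifold IZ ∞ Z]

/-- Two horizontal lifts that differ by `g` at time `0` differ by `g` at all times. -/
theorem IsHorizontalLift.eq_smul (hπ : IsPrincipalCircleBundle IX IZ π)
    (hA : IsConnectionForm IZ A) {γ : SmoothLoop IX X} {y y' : ℝ → Z}
    (hy : IsHorizontalLift IX IZ π A γ y) (hy' : IsHorizontalLift IX IZ π A γ y')
    {g₀ : Circle} (h0 : y' 0 = g₀ • y 0) (s : ℝ) : y' s = g₀ • y s := by
  have := hπ.contMDiffSMul
  choose g hg using fun s => hπ.exists_smul_eq (z := y s) (z' := y' s)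
    ((hy'.proj_eq s).trans (hy.proj_eq s).symm)
  have hG := hπ.differentiable_of_smul_eq hy.contMDiff hy'.contMDiff hg
  have hderiv : ∀ s, HasDerivAt (fun t => (g t : ℂ)) 0 s := by
    intro s
    -- An angle of `g` relative to `g s`. It may jump elsewhere, but at `t = s` the quotient is `1`,
    -- away from the branch cut, so `φ` is differentiable at `s`, and only that is used.
    let φ : ℝ → ℝ := fun t => Complex.arg ((g t / g s : Circle) : ℂ) / (2 * Real.pi)
    have hφg : ∀ t, g t = Circle.exp (2 * Real.pi * φ t) * g s := by
      intro t
      simp only [φ]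
      rw [mul_div_cancel₀ _ (by positivity), Circle.exp_arg, div_mul_cancel]
    have hφd : DifferentiableAt ℝ φ s := by
      refine DifferentiableAt.div_const ?_ _
      have h1 : DifferentiableAt ℝ (fun t => Complex.log ((g t / g s : Circle) : ℂ)) s := by
        refine ((Complex.differentiableAt_log (by simp)).restrictScalars ℝ).comp s
          (f := fun t => ((g t / g s : Circle) : ℂ)) ?_
        simp only [Circle.coe_div]
        exact (hG s).div_const _
      exact (Complex.imCLM.differentiableAt.comp s h1).congr_of_eventuallyEq
        (Filter.Eventually.of_forall fun t => (Complex.log_im _).symm)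
    have hφ0 : deriv φ s = 0 := by
      have hyd : MDifferentiableAt 𝓘(ℝ, ℝ) IZ y s := hy.contMDiff.mdifferentiable (by simp) s
      have h1 := hA.form_velocity_orbitCurve (x := fun t => g s • y t) hφd.hasDerivAt
        (((contMDiff_const_smul_circle (g s)).comp hy.contMDiff).mdifferentiable (by simp) s)
      have h2 : y' = fun t => orbitCurve (g s • y t) (φ t) := by
        funext t
        rw [hg, hφg, orbitCurve, mul_smul]
      rw [← form_velocity_congr A (Filter.EventuallyEq.of_eq h2), hy'.horizontal,
        hA.form_velocity_smul _ hyd, hy.horizontal, add_zero] at h1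
      exact h1.symm
    have h2 : (fun t => (g t : ℂ)) =
        fun t => Complex.exp (((2 * Real.pi * φ t : ℝ) : ℂ) * Complex.I) * g s := by
      funext t
      rw [hφg t, Circle.coe_mul, Circle.coe_exp]
    have h3 := hφd.hasDerivAt
    rw [hφ0] at h3
    rw [h2]
    have h4 := ((((h3.const_mul (2 * Real.pi)).ofReal_comp).mul_const Complex.I).cexp).mul_const
      (g s : ℂ)
    simpa using h4
  have hconst : g s = g₀ := by
    have h1 : (g s : ℂ) = g 0 := is_const_of_deriv_eq_zero hG (fun t => (hderiv t).deriv) s 0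
    rw [Circle.coe_inj.1 h1]
    exact hπ.smul_left_injective (y 0) ((hg 0).symm.trans h0)
  rw [hg, hconst]

/-- A loop in `Z`, corrected by the integral of the connection form along it, is a horizontal lift
of its projection. -/
theorem isHorizontalLift_orbitCurve_integral (hπ : IsPrincipalCircleBundle IX IZ π)
    (hA : IsConnectionForm IZ A) (x : SmoothLoop IZ Z) (g : Circle) :
    IsHorizontalLift IX IZ π A (x.map π hπ.contMDiff_proj) fun s =>
      orbitCurve (g • x.toFun s)
        (-∫ r in (0 : ℝ)..s, A (x.toFun r) (velocity IZ x.toFun r)) := by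
  have := hπ.contMDiffSMul
  have ha := contDiff_form_velocity hA.contMDiff x.contMDiff
  have hd : ∀ s, HasDerivAt (fun s => -∫ r in (0 : ℝ)..s, A (x.toFun r) (velocity IZ x.toFun r))
      (-A (x.toFun s) (velocity IZ x.toFun s)) s := fun s =>
    (ha.continuous.integral_hasStrictDerivAt 0 s).hasDerivAt.neg
  have hsm : ContDiff ℝ ∞
      fun s => -∫ r in (0 : ℝ)..s, A (x.toFun r) (velocity IZ x.toFun r) := by
    refine contDiff_infty_iff_deriv.2 ⟨fun s => (hd s).differentiableAt, ?_⟩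
    rw [funext fun s => (hd s).deriv]
    exact ha.neg
  have hgx : ContMDiff 𝓘(ℝ, ℝ) IZ ∞ fun s => g • x.toFun s :=
    (contMDiff_const_smul_circle g).comp x.contMDiff
  refine ⟨contMDiff_orbitCurve_uncurry.comp (hsm.contMDiff.prodMk hgx), fun s => ?_, fun s => ?_⟩
  · rw [orbitCurve, hπ.proj_smul, hπ.proj_smul]
    rfl
  · rw [hA.form_velocity_orbitCurve (hd s) (hgx.mdifferentiable (by simp) s),
      hA.form_velocity_smul g (x.contMDiff.mdifferentiable (by simp) s), neg_add_cancel]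

/-- The holonomy along the projection of a loop `x` is `exp (-2πi ∫ A(ẋ))`. -/
theorem isHolonomy_map_iff (hπ : IsPrincipalCircleBundle IX IZ π)
    (hA : IsConnectionForm IZ A) (x : SmoothLoop IZ Z) (g : Circle) :
    IsHolonomy IX IZ π A (x.map π hπ.contMDiff_proj) g ↔
      g = Circle.exp (2 * Real.pi *
        -∫ s in (0 : ℝ)..1, A (x.toFun s) (velocity IZ x.toFun s)) := by
  have hx1 : x.toFun 1 = x.toFun 0 := by simpa using x.periodic 0
  have hlift := isHorizontalLift_orbitCurve_integral hπ hA x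
  have hstart : ∀ h : Circle, orbitCurve (h • x.toFun 0)
      (-∫ r in (0 : ℝ)..0, A (x.toFun r) (velocity IZ x.toFun r)) = h • x.toFun 0 := by
    intro h
    simp [orbitCurve]
  constructor
  · intro hg
    -- One explicit lift, from `x 0`, determines `g` because the action is free.
    have h1 := (hg (x.toFun 0) rfl).2 _ (hlift 1) (by rw [hstart, one_smul])
    rw [one_smul, hx1] at h1
    exact (hπ.smul_left_injective (x.toFun 0) h1).symm
  · rintro rfl z hz
    obtain ⟨h, rfl⟩ := hπ.exists_smul_eq hz
    refine ⟨⟨_, hlift h, hstart h⟩, fun y hy hy0 => ?_⟩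
    -- With `g₀ = 1` this is uniqueness of the horizontal lift from a given point.
    have h1 := IsHorizontalLift.eq_smul hπ hA (hlift h) hy (g₀ := 1)
      (by rw [hy0, hstart, one_smul]) 1
    rw [h1, one_smul, hx1, orbitCurve]

theorem holonomy_map_eq (hπ : IsPrincipalCircleBundle IX IZ π)
    (hA : IsConnectionForm IZ A) (x : SmoothLoop IZ Z) :
    holonomy IX IZ π A (x.map π hπ.contMDiff_proj) =
      Circle.exp (2 * Real.pi *
        -∫ s in (0 : ℝ)..1, A (x.toFun s) (velocity IZ x.toFun s)) :=
  (isHolonomy_map_iff hπ hA x _).1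
    (Classical.epsilon_spec ⟨_, (isHolonomy_map_iff hπ hA x _).2 rfl⟩)

theorem holonomy_map_eq_one_iff (hπ : IsPrincipalCircleBundle IX IZ π)
    (hA : IsConnectionForm IZ A) (x : SmoothLoop IZ Z) :
    holonomy IX IZ π A (x.map π hπ.contMDiff_proj) = 1 ↔
      ∃ m : ℤ, (∫ s in (0 : ℝ)..1, A (x.toFun s) (velocity IZ x.toFun s)) = m := by
  rw [holonomy_map_eq hπ hA, Circle.exp_eq_one]
  constructor
  · rintro ⟨n, hn⟩
    refine ⟨-n, ?_⟩
    have h2 : (2 * Real.pi) ≠ 0 := by positivity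
    rw [mul_comm (n : ℝ)] at hn
    have := mul_left_cancel₀ h2 hn
    push_cast
    linarith
  · rintro ⟨m, hm⟩
    refine ⟨-m, ?_⟩
    rw [hm]
    push_cast
    ring

theorem exists_integral_eq_of_mem_windingQLoopSpace (hA : IsConnectionForm IZ A)
    {x : SmoothLoop IZ Z} (hx : x ∈ windingQLoopSpace IZ A) :
    ∃ m : ℤ, (∫ s in (0 : ℝ)..1, A (x.toFun s) (velocity IZ x.toFun s)) = m := by
  have hc := (contDiff_form_velocity hA.contMDiff x.contMDiff).continuous
  obtain ⟨m, hm⟩ := hx 0 (by simp)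
  refine ⟨m, ?_⟩
  have h1 : ∀ s ∈ Set.Icc (0 : ℝ) 1, A (x.toFun s) (velocity IZ x.toFun s) = m := by
    intro s hs
    rw [← hm]
    -- A continuous map from an interval to the discrete set of integers is constant.
    refine isPreconnected_Icc.constant_of_mapsTo (T := Set.range ((↑) : ℤ → ℝ))
      Int.isClosedEmbedding_coe_real.isInducing.isDiscrete_range hc.continuousOn
      (fun t ht => ?_) hs (by simp)
    obtain ⟨k, hk⟩ := hx t ht
    exact ⟨k, hk.symm⟩
  rw [intervalIntegral.integral_congr (g := fun _ => (m : ℝ))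
    (fun s hs => h1 s (by rwa [Set.uIcc_of_le zero_le_one] at hs))]
  simp

end Bundle

end CircleBundle

theorem mainTheorem7
    {EX : Type*} [NormedAddCommGroup EX] [NormedSpace ℝ EX] [FiniteDimensional ℝ EX]
    {HX : Type*} [TopologicalSpace HX] (IX : ModelWithCorners ℝ EX HX)
    {X : Type*} [TopologicalSpace X] [ChartedSpace HX X] [IsManifold IX ∞ X]
    [BoundarylessManifold IX X] [T2Space X] [SecondCountableTopology X]
    {EZ : Type*} [NormedAddCommGroup EZ] [NormedSpace ℝ EZ] [FiniteDimensional ℝ EZ]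
    {HZ : Type*} [TopologicalSpace HZ] (IZ : ModelWithCorners ℝ EZ HZ)
    {Z : Type*} [TopologicalSpace Z] [ChartedSpace HZ Z] [IsManifold IZ ∞ Z]
    [BoundarylessManifold IZ Z] [T2Space Z] [SecondCountableTopology Z]
    [MulAction Circle Z] (π : Z → X)
    (hπ : CircleBundle.IsPrincipalCircleBundle IX IZ π)
    (A : ∀ z : Z, TangentSpace IZ z →L[ℝ] ℝ)
    (hA : CircleBundle.IsConnectionForm IZ A) :
    (∀ x : CircleBundle.SmoothLoop IZ Z,
      ∃! g : Circle, CircleBundle.IsHolonomy IX IZ π A (x.map π hπ.contMDiff_proj) g) ∧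
    (∀ x ∈ CircleBundle.windingQLoopSpace IZ A,
      CircleBundle.holonomy IX IZ π A (x.map π hπ.contMDiff_proj) = 1) ∧
    ∀ x : CircleBundle.SmoothLoop IZ Z,
      (∃ m : ℤ, (∫ s in (0 : ℝ)..1, A (x.toFun s) (CircleBundle.velocity IZ x.toFun s)) = m) ↔
        CircleBundle.holonomy IX IZ π A (x.map π hπ.contMDiff_proj) = 1 := by
  refine ⟨fun x => ?_, fun x hx => ?_, fun x => ?_⟩
  · simp only [CircleBundle.isHolonomy_map_iff hπ hA]
    exact existsUnique_eq
  · exact (CircleBundle.holonomy_map_eq_one_iff hπ hA x).2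
      (CircleBundle.exists_integral_eq_of_mem_windingQLoopSpace hA hx)
  · exact (CircleBundle.holonomy_map_eq_one_iff hπ hA x).symm
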